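/- All graphs are finite, undirected, without self-loops and parallel edges; a graph class is an arbitrary collection of graphs. Definitions: - For $r\in\mathbb N$, a graph $H$ is a depth-$r$ minor of a graph $G$ if there are pairwise disjoint non-empty sets $B_h\subseteq V(G)$, $h\in V(H)$, such that each induced subgraph $G[B_h]$ has radius at most $r$ (that is, some vertex of $B_h$ is at distance at most $r$ in $G[B_h]$ from every vertex of $B_h$), and for every edge $hh'\in E(H)$ there is an edge of $G$ between $B_h$ and $B_{h'}$. - A graph class $\mathcal C$ has bounded expansion if for every $r\in\mathbb N$ there is a constant $c$ such that $|E(H)|\le c\,|V(H)|$ for every depth-$r$ minor $H$ of every $G\in\mathcal C$. - For a graph $G$, $r\in\mathbb N\cup\{\infty\}$, $S\subseteq V(G)$ and $v\in V(G)\setminus S$, $\operatorname{sep}_r(v/S)$ is the set of those vertices in $S$ that can be reached from $v$ by a path of length at most $r$ whose inner vertices are disjoint from $S$. - The radius-$r$ separation-width $\operatorname{sw}_r(G)$ is the least number $k\in\mathbb N$ for which there is a total order $\le$ on $V(G)$ such that $|\operatorname{sep}_r(v/S)|\le k$ for every $\le$-downward closed set $S\subseteq V(G)$ and every $v\in V(G)\setminus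 S$. For a graph class $\mathcal C$, $\operatorname{sw}_r(\mathcal C)=\sup_{G\in\mathcal C}\operatorname{sw}_r(G)$. **Corollary 1.8.** Let $\mathcal C$ be a class of graphs. Then $\mathcal C$ has bounded expansion if and only if $\operatorname{sw}_r(\mathcal C)<\infty$ for every $r\in\mathbb N$. -/

import Mathlib

universe u

/-- A finite, undirected graph without self-loops and parallel edges. -/
structure FiniteGraph : Type (u + 1) where
  /-- the vertices -/
  V : Type u
  /-- there are finitely many of them -/
  finite : Finite V
  /-- the graph itself -/
  graph : SimpleGraph V

/-- A graph class: any collection of finite graphs. -/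
abbrev GraphClass : Type (u + 1) := Set FiniteGraph.{u}

namespace FiniteGraph

/-- `H` is a depth-`r` (shallow) minor of `G`: there are pairwise disjoint branch sets `B h` in `G`,
one for each vertex `h` of `H`, such that every `G[B h]` has radius at most `r` (each of its
vertices is reached from the centre `c h` by a walk of length at most `r` inside `B h`), and
adjacent vertices of `H` have branch sets that are joined by an edge of `G`. As the last condition
is an implication only, deletion of edges is allowed. -/
def IsShallowMinor (r : ℕ) (H G : FiniteGraph.{u}) : Prop :=
  ∃ (B : H.V → Set G.V) (c : H.V → G.V),
    (∀ h h' : H.V, h ≠ h' → Disjoint (B h) (B h')) ∧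
    (∀ h : H.V, c h ∈ B h) ∧
    (∀ h : H.V, ∀ x ∈ B h, ∃ p : G.graph.Walk (c h) x,
      p.length ≤ r ∧ ∀ w ∈ p.support, w ∈ B h) ∧
    (∀ h h' : H.V, H.graph.Adj h h' → ∃ x ∈ B h, ∃ y ∈ B h', G.graph.Adj x y)

/-- The `r`-separator of `v` in `S` (meant for `v ∉ S`): the vertices `u` of `S` that are reached
from `v` by a path of length at most `r` whose inner vertices are disjoint from `S`. -/
def sep (G : FiniteGraph.{u}) (r : ℕ∞) (v : G.V) (S : Set G.V) : Set G.V :=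
  {u | u ∈ S ∧ ∃ p : G.graph.Walk v u,
    p.IsPath ∧ (p.length : ℕ∞) ≤ r ∧ ∀ w ∈ p.support, w ≠ v → w ≠ u → w ∉ S}

/-- The radius-`r` separation-width of `G`: the least `k` for which there is a total order on the
vertices such that `r`-separators in downward closed sets have size at most `k`. -/
noncomputable def sepWidth (G : FiniteGraph.{u}) (r : ℕ∞) : ℕ :=
  sInf {k : ℕ | ∃ _ : LinearOrder G.V, ∀ S : Set G.V, IsLowerSet S →
    ∀ v : G.V, v ∉ S → (G.sep r v S).encard ≤ k}

/-- The infimum that defines the separation-width is over a non-empty set. -/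
theorem sepWidth_set_nonempty (G : FiniteGraph.{u}) (r : ℕ∞) :
    {k : ℕ | ∃ _ : LinearOrder G.V, ∀ S : Set G.V, IsLowerSet S →
      ∀ v : G.V, v ∉ S → (G.sep r v S).encard ≤ k}.Nonempty := by
  classical
  have := G.finite
  obtain ⟨n, ⟨e⟩⟩ := Finite.exists_equiv_fin G.V
  refine ⟨Nat.card G.V, LinearOrder.lift' e e.injective, fun S _ v _ => ?_⟩
  rw [← (Set.toFinite (G.sep r v S)).cast_ncard_eq]
  exact_mod_cast Set.ncard_le_card _

end FiniteGraph

namespace GraphClass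

/-- Bounded expansion: for every `r`, the edge density `|E(H)| / |V(H)|` of the depth-`r` minors `H`
of members of the class is bounded by a constant. -/
def BoundedExpansion (C : GraphClass.{u}) : Prop :=
  ∀ r : ℕ, ∃ c : ℕ, ∀ G ∈ C, ∀ H : FiniteGraph.{u}, H.IsShallowMinor r G →
    H.graph.edgeSet.ncard ≤ c * Nat.card H.V

/-- The supremum of the radius-`r` separation-width over the members of the class. -/
noncomputable def sepWidth (C : GraphClass.{u}) (r : ℕ∞) : ℕ∞ :=
  ⨆ G ∈ C, (G.sepWidth r : ℕ∞)

end GraphClass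

/-! From separators to density: order the vertices of a depth-`r` minor by the minima of their
branch sets. An earlier neighbour of `b` yields a walk of length at most `4 * r + 1` from the
minimum of `B b` to a smaller vertex. Its first smaller vertex lies in the neighbour's branch set
and in a separator, so back-degrees are bounded.

From density to separators, the link is admissibility, measured by fans. By
`FiniteGraph.exists_no_fan`, sparse depth-`2 * r` minors force every nonempty `S` to contain a
vertex without a `K`-fan into `S`: otherwise, a maximal family of disjoint short connections between
pairs in `S` gives a sparse minor on `S`, hence a large independent set `R`. By maximality the fans
of different members of `R` are disjoint once cut at the connections, and contracting them gives too
dense a minor. Placing such vertices last, one after another, yields an order without `K`-fans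
(`exists_linearOrder_of_no_fan`). In that order a search tree from `v` branches at most `K` times
per node towards `S`, so separators have size at most `K ^ r` (`ncard_le_of_no_fan`). -/

/-! ### Small separators give sparse shallow minors -/

/-- A walk from outside `S` into `S` yields a path that meets `S` in its last vertex only. -/
theorem SimpleGraph.Walk.exists_isPath_first_hit {V : Type*} {G : SimpleGraph V} (S : Set V)
    {a b : V} (p : G.Walk a b) (ha : a ∉ S) (hb : b ∈ S) :
    ∃ (u : V) (q : G.Walk a u), u ∈ S ∧ q.IsPath ∧ q.length ≤ p.length ∧
      (∀ w ∈ q.support, w ∈ p.support) ∧ ∀ w ∈ q.support, w ≠ u → w ∉ S := by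
  classical
  suffices h : ∃ (u : V) (q : G.Walk a u), u ∈ S ∧ q.length ≤ p.length ∧
      (∀ w ∈ q.support, w ∈ p.support) ∧ ∀ w ∈ q.support, w ≠ u → w ∉ S by
    obtain ⟨u, q, hu, hl, hs, hq⟩ := h
    exact ⟨u, q.bypass, hu, q.bypass_isPath, q.length_bypass_le_length.trans hl,
      fun w hw => hs w (q.support_bypass_subset_support hw),
      fun w hw => hq w (q.support_bypass_subset_support hw)⟩
  induction p with
  | nil => exact absurd hb ha
  | @cons a c b h p ih =>
    by_cases hc : c ∈ S
    · refine ⟨c, .cons h .nil, hc, by simp, ?_, ?_⟩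
      · intro w hw
        simp only [SimpleGraph.Walk.support_cons, SimpleGraph.Walk.support_nil, List.mem_cons,
          List.not_mem_nil, or_false] at hw ⊢
        rcases hw with rfl | rfl
        · exact .inl rfl
        · exact .inr p.start_mem_support
      · intro w hw hne
        simp only [SimpleGraph.Walk.support_cons, SimpleGraph.Walk.support_nil, List.mem_cons,
          List.not_mem_nil, or_false] at hw
        rcases hw with rfl | rfl
        · exact ha
        · exact absurd rfl hne
    · obtain ⟨u, q, hu, hl, hs, hq⟩ := ih hc hb
      refine ⟨u, .cons h q, hu, by simpa using hl, ?_, ?_⟩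
      · intro w hw
        simp only [SimpleGraph.Walk.support_cons, List.mem_cons] at hw ⊢
        exact hw.imp_right (hs w)
      · intro w hw hne
        simp only [SimpleGraph.Walk.support_cons, List.mem_cons] at hw
        rcases hw with rfl | hw
        · exact ha
        · exact hq w hw hne

/-- If all `m`-smaller neighbourhoods have at most `k` elements, there are at most `k` edges per
vertex. -/
theorem SimpleGraph.ncard_edgeSet_le_of_back_degree {V W : Type*} [Finite V] [LinearOrder W]
    (H : SimpleGraph V) (m : V → W) (hm : Function.Injective m) (k : ℕ)
    (hk : ∀ b, {a | H.Adj a b ∧ m a < m b}.ncard ≤ k) :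
    H.edgeSet.ncard ≤ k * Nat.card V := by
  classical
  have := Fintype.ofFinite V
  have hsub : H.edgeSet ⊆ ⋃ b ∈ (Finset.univ : Finset V),
      (fun a => s(a, b)) '' {a | H.Adj a b ∧ m a < m b} := by
    intro e
    induction e using Sym2.ind with
    | _ a b =>
      intro h
      rw [SimpleGraph.mem_edgeSet] at h
      rcases lt_or_gt_of_ne (hm.ne h.ne) with hlt | hlt
      · simp only [Set.mem_iUnion]
        exact ⟨b, Finset.mem_univ _, a, ⟨h, hlt⟩, rfl⟩
      · simp only [Set.mem_iUnion]
        exact ⟨a, Finset.mem_univ _, b, ⟨h.symm, hlt⟩, Sym2.eq_swap⟩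
  calc H.edgeSet.ncard ≤ _ := Set.ncard_le_ncard hsub (Set.toFinite _)
    _ ≤ ∑ b : V, ((fun a => s(a, b)) '' {a | H.Adj a b ∧ m a < m b}).ncard :=
        Finset.set_ncard_biUnion_le _ _
    _ ≤ ∑ _b : V, k := Finset.sum_le_sum fun b _ => (Set.ncard_image_le (Set.toFinite _)).trans (hk b)
    _ = k * Nat.card V := by simp [mul_comm]

/-- An order with small radius-`(4 * r + 1)` separators makes the depth-`r` minors sparse. -/
theorem FiniteGraph.IsShallowMinor.ncard_edgeSet_le {r k : ℕ} {H G : FiniteGraph.{u}}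
    (hHG : H.IsShallowMinor r G) [LinearOrder G.V]
    (hk : ∀ S : Set G.V, IsLowerSet S → ∀ v : G.V, v ∉ S →
      (G.sep ((4 * r + 1 : ℕ) : ℕ∞) v S).encard ≤ k) :
    H.graph.edgeSet.ncard ≤ k * Nat.card H.V := by
  classical
  have := G.finite
  have := H.finite
  obtain ⟨B, c, hdisj, hc, hrad, hadj⟩ := hHG
  have hmin : ∀ h, ∃ x ∈ B h, ∀ y ∈ B h, x ≤ y := fun h => by
    obtain ⟨x, hx, hx'⟩ := Set.exists_min_image (B h) id (Set.toFinite _) ⟨c h, hc h⟩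
    exact ⟨x, hx, hx'⟩
  choose m hmB hm using hmin
  have hinj : Function.Injective m := fun a b hab => by
    by_contra hne
    exact Set.disjoint_left.1 (hdisj a b hne) (hmB a) (hab ▸ hmB b)
  refine H.graph.ncard_edgeSet_le_of_back_degree m hinj k fun b => ?_
  have key : ∀ a, H.graph.Adj a b ∧ m a < m b →
      ∃ u ∈ B a, u ∈ G.sep ((4 * r + 1 : ℕ) : ℕ∞) (m b) (Set.Iio (m b)) := by
    rintro a ⟨hab, hlt⟩
    obtain ⟨x, hx, y, hy, hxy⟩ := hadj a b hab
    obtain ⟨p₁, hp₁, hs₁⟩ := hrad b _ (hmB b)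
    obtain ⟨p₂, hp₂, hs₂⟩ := hrad b _ hy
    obtain ⟨p₃, hp₃, hs₃⟩ := hrad a _ hx
    obtain ⟨p₄, hp₄, hs₄⟩ := hrad a _ (hmB a)
    -- Four radii and one edge: minimum of `B b`, centre, `y`, `x`, centre of `B a`, minimum of `B
    -- a`.
    let p := (p₁.reverse.append p₂).append (.cons hxy.symm (p₃.reverse.append p₄))
    have hpl : p.length ≤ 4 * r + 1 := by
      simp only [p, SimpleGraph.Walk.length_append, SimpleGraph.Walk.length_cons,
        SimpleGraph.Walk.length_reverse]
      omega
    have hps : ∀ w ∈ p.support, w ∈ B a ∨ w ∈ B b := by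
      intro w hw
      simp only [p, SimpleGraph.Walk.mem_support_append_iff, SimpleGraph.Walk.support_cons,
        List.mem_cons, SimpleGraph.Walk.support_reverse, List.mem_reverse] at hw
      rcases hw with (hw | hw) | rfl | hw | hw
      · exact .inr (hs₁ w hw)
      · exact .inr (hs₂ w hw)
      · exact .inr hy
      · exact .inl (hs₃ w hw)
      · exact .inl (hs₄ w hw)
    obtain ⟨u, q, hu, hq, hql, hqs, hqS⟩ :=
      p.exists_isPath_first_hit (Set.Iio (m b)) (by simp) hlt
    refine ⟨u, ?_, hu, q, hq, by exact_mod_cast hql.trans hpl, fun w hw _ h => hqS w hw h⟩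
    exact (hps u (hqs u q.end_mem_support)).resolve_right fun h => not_lt_of_ge (hm b u h) hu
  have : Nonempty G.V := ⟨m b⟩
  choose! f hfB hf using key
  have hle := hk _ (isLowerSet_Iio (m b)) (m b) (by simp)
  rw [← (Set.toFinite (G.sep _ (m b) _)).cast_ncard_eq] at hle
  refine (Set.ncard_le_ncard_of_injOn f hf ?_ (Set.toFinite _)).trans (by exact_mod_cast hle)
  intro a ha a' ha' h
  by_contra hne
  exact Set.disjoint_left.1 (hdisj a a' hne) (hfB a ha) (h ▸ hfB a' ha')

/-! ### Fans -/

/-- A fan from `v` into `S`: walks of positive length at most `r` from `v` to elements of `S` other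
than `v`, with inner vertices outside `S`, which share no vertex after the first one. -/
structure IsFan {V ι : Type*} (G : SimpleGraph V) (r : ℕ) (S : Set V) (v : V)
    (p : ι → ℕ → V) (l : ι → ℕ) : Prop where
  length_pos : ∀ i, 0 < l i
  length_le : ∀ i, l i ≤ r
  start : ∀ i, p i 0 = v
  adj : ∀ i j, j < l i → G.Adj (p i j) (p i (j + 1))
  last_mem : ∀ i, p i (l i) ∈ S
  last_ne : ∀ i, p i (l i) ≠ v
  inner : ∀ i j, 0 < j → j < l i → p i j ∉ S
  disj : ∀ i j i' j', 0 < j → j ≤ l i → 0 < j' → j' ≤ l i' → p i j = p i' j' → i = i'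

namespace IsFan

variable {V ι : Type*} {G : SimpleGraph V} {r : ℕ} {S M : Set V} {v : V} {p : ι → ℕ → V} {l : ι → ℕ}

/-- The walks of a fan can be stopped where they enter a larger set. -/
theorem truncate (h : IsFan G r S v p l) (hv : v ∈ S) (hSM : S ⊆ M) :
    ∃ l', (∀ i, l' i ≤ l i) ∧ IsFan G r M v p l' := by
  classical
  have hex : ∀ i, ∃ j, 0 < j ∧ p i j ∈ M := fun i => ⟨l i, h.length_pos i, hSM (h.last_mem i)⟩
  have hle : ∀ i, Nat.find (hex i) ≤ l i := fun i =>
    Nat.find_min' _ ⟨h.length_pos i, hSM (h.last_mem i)⟩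
  refine ⟨fun i => Nat.find (hex i), hle, fun i => (Nat.find_spec (hex i)).1,
    fun i => (hle i).trans (h.length_le i), h.start, fun i j hj => h.adj i j (hj.trans_le (hle i)),
    fun i => (Nat.find_spec (hex i)).2, fun i => ?_, fun i j hj hlt hM => ?_, ?_⟩
  -- A walk cut early ends at a former inner vertex, which is not `v` because `v ∈ S`.
  · rcases (hle i).lt_or_eq with hlt | heq
    · exact fun h' => h.inner i _ (Nat.find_spec (hex i)).1 hlt (h' ▸ hv)
    · rw [heq]; exact h.last_ne i
  · exact Nat.find_min (hex i) hlt ⟨hj, hM⟩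
  · exact fun _ _ _ _ h1 h2 h3 h4 => h.disj _ _ _ _ h1 (h2.trans (hle _)) h3 (h4.trans (hle _))

theorem reindex {κ : Type*} (h : IsFan G r S v p l) (f : κ → ι) (hf : Function.Injective f) :
    IsFan G r S v (fun i => p (f i)) (fun i => l (f i)) :=
  ⟨fun _ => h.length_pos _, fun _ => h.length_le _, fun _ => h.start _, fun _ => h.adj _,
    fun _ => h.last_mem _, fun _ => h.last_ne _, fun _ => h.inner _,
    fun _ _ _ _ h1 h2 h3 h4 h5 => hf (h.disj _ _ _ _ h1 h2 h3 h4 h5)⟩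

theorem last_injective (h : IsFan G r S v p l) : Function.Injective fun i => p i (l i) :=
  fun _ _ heq => h.disj _ _ _ _ (h.length_pos _) le_rfl (h.length_pos _) le_rfl heq

end IsFan

/-- `v` has a fan of size `K` into `S`. -/
def HasFan {V : Type*} (G : SimpleGraph V) (r K : ℕ) (S : Set V) (v : V) : Prop :=
  ∃ (p : Fin K → ℕ → V) (l : Fin K → ℕ), IsFan G r S v p l

theorem exists_walk_of_seq {V : Type*} {G : SimpleGraph V} (p : ℕ → V) (n : ℕ)
    (h : ∀ j < n, G.Adj (p j) (p (j + 1))) :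
    ∃ q : G.Walk (p 0) (p n), q.length = n ∧ ∀ w ∈ q.support, ∃ j ≤ n, w = p j := by
  induction n with
  | zero => exact ⟨.nil, rfl, fun w hw => ⟨0, le_rfl, by simpa using hw⟩⟩
  | succ n ih =>
    obtain ⟨q, hq, hs⟩ := ih fun j hj => h j (by omega)
    refine ⟨q.concat (h n (by omega)), by simp [hq], fun w hw => ?_⟩
    rw [SimpleGraph.Walk.support_concat, List.mem_append] at hw
    rcases hw with hw | hw
    · obtain ⟨j, hj, rfl⟩ := hs w hw
      exact ⟨j, by omega, rfl⟩
    · exact ⟨n + 1, le_rfl, by simpa using hw⟩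

/-! ### Separators in an order without large fans -/

/-- Reachability from `v` in exactly `n` steps by a walk with all but the last vertex outside `S`. -/
def ReachAvoid {V : Type*} (G : SimpleGraph V) (S : Set V) (v : V) : ℕ → V → Prop
  | 0, x => x = v
  | n + 1, x => ∃ y, y ∉ S ∧ ReachAvoid G S v n y ∧ G.Adj y x

/-- A breadth-first search tree from `v` whose inner nodes are outside `S`. -/
theorem exists_search_tree {V : Type*} (G : SimpleGraph V) (S : Set V) (v : V) :
    ∃ (D : V → ℕ) (π : V → V),
      (∀ x n, (∃ m, ReachAvoid G S v m x) → D x = n + 1 →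
        (∃ m, ReachAvoid G S v m (π x)) ∧ D (π x) = n ∧ π x ∉ S ∧ G.Adj (π x) x) ∧
      (∀ x, (∃ m, ReachAvoid G S v m x) → D x = 0 → x = v) ∧
      (∀ x m, ReachAvoid G S v m x → D x ≤ m) ∧ D v = 0 := by
  classical
  -- Unreachable vertices get the junk value `0`, so statements about `D` carry a reachability
  -- hypothesis.
  let D : V → ℕ := fun x => sInf {m | ReachAvoid G S v m x}
  have hD : ∀ x m, ReachAvoid G S v m x → D x ≤ m := fun x m h => Nat.sInf_le h
  have hD' : ∀ x, (∃ m, ReachAvoid G S v m x) → ReachAvoid G S v (D x) x :=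
    fun x h => Nat.sInf_mem (s := {m | ReachAvoid G S v m x}) h
  have hpar : ∀ x, ∃ y, ∀ n, (∃ m, ReachAvoid G S v m x) → D x = n + 1 →
      (∃ m, ReachAvoid G S v m y) ∧ D y = n ∧ y ∉ S ∧ G.Adj y x := by
    intro x
    by_cases h : (∃ m, ReachAvoid G S v m x) ∧ D x ≠ 0
    · obtain ⟨n, hn⟩ := Nat.exists_eq_succ_of_ne_zero h.2
      have h1 := hD' x h.1
      rw [hn] at h1
      obtain ⟨y, hy, hr, hadj⟩ := h1
      refine ⟨y, fun n' _ hn' => ⟨⟨n, hr⟩, ?_, hy, hadj⟩⟩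
      obtain rfl : n' = n := by omega
      refine le_antisymm (hD y _ hr) ?_
      have : D x ≤ D y + 1 := hD x _ ⟨y, hy, hD' y ⟨_, hr⟩, hadj⟩
      omega
    · exact ⟨x, fun n hx hn => absurd ⟨hx, by omega⟩ h⟩
  choose π hπ using hpar
  refine ⟨D, π, fun x n hx hn => hπ x n hx hn, fun x hx h0 => ?_, hD, ?_⟩
  · have := hD' x hx
    rwa [h0] at this
  · exact Nat.le_zero.1 (hD v 0 rfl)

/-- If a tree node `x` outside `S` has several children with descendants in `S`, the tree paths to
these descendants form a fan from `x`. Hence fewer than `K` fan walks means at most `K` relevant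
children, and the depth is at most `r`. -/
theorem ncard_le_of_no_fan {V : Type*} [Finite V] [LinearOrder V] {G : SimpleGraph V} {r K : ℕ}
    (hK : ∀ x, ¬ HasFan G r K (Set.Iic x) x) {S : Set V} (hS : IsLowerSet S) {v : V} (hv : v ∉ S) :
    {u ∈ S | ∃ m ≤ r, ReachAvoid G S v m u}.ncard ≤ K ^ r := by
  classical
  obtain ⟨D, π, hpar, hroot, hD, hDv⟩ := exists_search_tree G S v
  let R : V → Prop := fun x => ∃ m, ReachAvoid G S v m x
  have hiter : ∀ j x, R x → j ≤ D x → R (π^[j] x) ∧ D (π^[j] x) + j = D x := by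
    intro j
    induction j with
    | zero => exact fun x hx _ => ⟨hx, rfl⟩
    | succ j ih =>
      intro x hx hj
      obtain ⟨h1, h2⟩ := ih x hx (by omega)
      obtain ⟨h3, h4, -, -⟩ := hpar _ (D (π^[j] x) - 1) h1 (by omega)
      rw [Function.iterate_succ_apply']
      exact ⟨h3, by omega⟩
  -- Members of `S` at most `n` levels below `x` in the search tree.
  let T : ℕ → V → Set V := fun n x => {u | u ∈ S ∧ R u ∧ ∃ j ≤ n, D u = D x + j ∧ π^[j] u = x}
  have hKpos : 0 < K := by
    rcases Nat.eq_zero_or_pos K with rfl | h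
    · exact absurd ⟨fun i => i.elim0, fun i => i.elim0, by
        constructor <;> intro i <;> exact i.elim0⟩ (hK v)
    · exact h
  -- Parents lie outside `S`, so nodes in `S` are leaves.
  have hTS : ∀ n x, x ∈ S → (T n x).ncard ≤ 1 := by
    intro n x hx
    refine (Set.ncard_le_ncard (t := {x}) ?_ (Set.toFinite _)).trans (by simp)
    rintro u ⟨-, hu, j, -, hj, rfl⟩
    rcases j with _ | j
    · rfl
    · exfalso
      obtain ⟨h1, h2⟩ := hiter j u hu (by omega)
      rw [Function.iterate_succ_apply'] at hx
      exact (hpar _ (D (π^[j] u) - 1) h1 (by omega)).2.2.1 hx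
  have hT : ∀ n ≤ r, ∀ x, x ∉ S → (T n x).ncard ≤ K ^ n := by
    intro n
    induction n with
    | zero =>
      intro _ x hx
      have : T 0 x = ∅ := by
        ext u
        simp only [Set.mem_empty_iff_false, iff_false]
        rintro ⟨hu, -, j, hj, -, h⟩
        obtain rfl : j = 0 := by omega
        exact hx (h ▸ hu)
      simp [this]
    | succ n ih =>
      intro hn x hx
      let C : Set V := {c | R c ∧ π c = x ∧ D c = D x + 1 ∧ (T n c).Nonempty}
      have hCcard : C.ncard ≤ K := by
        by_contra hlt
        push Not at hlt
        have hchoice : ∀ c : C, ∃ u j, u ∈ S ∧ R u ∧ j ≤ n ∧ D u = D c.1 + j ∧ π^[j] u = c := by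
          rintro ⟨c, hc⟩
          obtain ⟨u, h1, h2, j, h3, h4, h5⟩ := hc.2.2.2
          exact ⟨u, j, h1, h2, h3, h4, h5⟩
        choose u j huS huR hjn hDu hπu using hchoice
        have hDc : ∀ c : C, D c.1 = D x + 1 := fun c => c.2.2.2.1
        have hπc : ∀ c : C, π c.1 = x := fun c => c.2.2.1
        -- The `i`-th vertex of a walk is the ancestor of `u c` lying `i` levels below `x`. The
        -- vertex `x` joins the target set because `truncate` needs the start in it.
        have hmain : IsFan G r (insert x S) x (fun (c : C) i => π^[j c + 1 - i] (u c))
            (fun c => j c + 1) := by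
          have hlev : ∀ (c : C) i, i ≤ j c + 1 → R (π^[j c + 1 - i] (u c)) ∧
              D (π^[j c + 1 - i] (u c)) = D x + i := fun c i hi => by
            have h1 := hDu c
            have h2 := hDc c
            obtain ⟨h3, h4⟩ := hiter (j c + 1 - i) (u c) (huR c) (by omega)
            exact ⟨h3, by omega⟩
          have hnx : ∀ (c : C) i, 0 < i → i ≤ j c + 1 → π^[j c + 1 - i] (u c) ≠ x := by
            intro c i h1 h2 h
            have := (hlev c i h2).2
            rw [h] at this
            omega
          refine ⟨fun c => by simp, fun c => ?_, fun c => ?_, fun c i hi => ?_, fun c => ?_,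
            fun c => ?_, fun c i hi hlt h => ?_, ?_⟩
          · have := hjn c
            omega
          · change π^[j c + 1] (u c) = x
            rw [Function.iterate_succ_apply', hπu, hπc]
          · obtain ⟨h1, h2⟩ := hlev c (i + 1) (by omega)
            have h3 := (hpar _ (D x + i) h1 (by omega)).2.2.2
            rw [← Function.iterate_succ_apply' (f := π)] at h3
            have : j c + 1 - i = (j c + 1 - (i + 1)).succ := by omega
            rw [this]
            exact h3
          · simpa using Or.inr (huS c)
          · exact hnx c _ (by omega) le_rfl
          · rcases h with h | h
            · exact hnx c i hi hlt.le h
            · obtain ⟨h1, h2⟩ := hlev c (i + 1) (by omega)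
              have h3 := (hpar _ (D x + i) h1 (by omega)).2.2.1
              rw [← Function.iterate_succ_apply' (f := π)] at h3
              have h4 : j c + 1 - i = (j c + 1 - (i + 1)).succ := by omega
              rw [h4] at h
              exact h3 h
          -- A common vertex has one level, so `i = i'`; its ancestor at level one below `x` is both
          -- `c` and `c'`.
          · intro c i c' i' h1 h2 h3 h4 h
            have hii : i = i' := by
              have e1 := (hlev c i h2).2
              have e2 := (hlev c' i' h4).2
              rw [h] at e1
              omega
            subst hii
            have hb : ∀ c : C, i ≤ j c + 1 → π^[i - 1] (π^[j c + 1 - i] (u c)) = c := by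
              intro c hi
              rw [← Function.iterate_add_apply]
              have : i - 1 + (j c + 1 - i) = j c := by omega
              rw [this, hπu]
            apply Subtype.ext
            rw [← hb c h2, ← hb c' h4]
            rw [h]
        obtain ⟨l', -, hfan⟩ := hmain.truncate (M := Set.Iic x) (Set.mem_insert _ _) (by
          intro y hy
          rcases hy with rfl | hy
          · exact le_rfl
          · exact le_of_not_ge fun h => hx (hS h hy))
        obtain ⟨f⟩ : Nonempty (Fin K ↪ C) := by
          have := Fintype.ofFinite C
          apply Function.Embedding.nonempty_of_card_le
          rw [Fintype.card_fin, ← Nat.card_eq_fintype_card]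
          exact hlt.le
        exact hK x ⟨_, _, hfan.reindex f f.injective⟩
      have hsub : T (n + 1) x ⊆ ⋃ c ∈ (Set.toFinite C).toFinset, T n c := by
        rintro u ⟨huS, huR, j, hj, hDu, hπu⟩
        rcases j with _ | j
        · exact absurd (hπu ▸ huS) hx
        · obtain ⟨h1, h2⟩ := hiter j u huR (by omega)
          have hmem : u ∈ T n (π^[j] u) := ⟨huS, huR, j, by omega, by omega, rfl⟩
          rw [Function.iterate_succ_apply'] at hπu
          simp only [Set.mem_iUnion, Set.Finite.mem_toFinset]
          exact ⟨π^[j] u, ⟨h1, hπu, by omega, u, hmem⟩, hmem⟩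
      calc (T (n + 1) x).ncard ≤ _ := Set.ncard_le_ncard hsub (Set.toFinite _)
        _ ≤ ∑ c ∈ (Set.toFinite C).toFinset, (T n c).ncard := Finset.set_ncard_biUnion_le _ _
        _ ≤ ∑ c ∈ (Set.toFinite C).toFinset, K ^ n := Finset.sum_le_sum fun c _ => by
            by_cases hc : c ∈ S
            · exact (hTS n c hc).trans (Nat.one_le_pow _ _ hKpos)
            · exact ih (by omega) c hc
        _ = C.ncard * K ^ n := by
            rw [Finset.sum_const, smul_eq_mul, ← Set.ncard_eq_toFinset_card C]
        _ ≤ K * K ^ n := Nat.mul_le_mul_right _ hCcard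
        _ = K ^ (n + 1) := (pow_succ' K n).symm
  refine (Set.ncard_le_ncard ?_ (Set.toFinite _)).trans (hT r le_rfl v hv)
  rintro u ⟨huS, m, hm, hu⟩
  have hle := hD u m hu
  obtain ⟨h1, h2⟩ := hiter (D u) u ⟨m, hu⟩ le_rfl
  exact ⟨huS, ⟨m, hu⟩, D u, by omega, by omega, hroot _ h1 (by omega)⟩

theorem FiniteGraph.encard_sep_le_of_no_fan {G : FiniteGraph.{u}} {r K : ℕ} [LinearOrder G.V]
    (hK : ∀ x, ¬ HasFan G.graph r K (Set.Iic x) x) {S : Set G.V} (hS : IsLowerSet S) {v : G.V}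
    (hv : v ∉ S) : (G.sep r v S).encard ≤ ((K ^ r : ℕ) : ℕ∞) := by
  have := G.finite
  rw [← (Set.toFinite (G.sep r v S)).cast_ncard_eq]
  refine Nat.cast_le.2 ((Set.ncard_le_ncard ?_ (Set.toFinite _)).trans (ncard_le_of_no_fan hK hS hv))
  rintro u ⟨huS, p, hp, hl, hin⟩
  refine ⟨huS, p.length, by exact_mod_cast hl, ?_⟩
  have hreach : ∀ i ≤ p.length, ReachAvoid G.graph S v i (p.getVert i) := by
    intro i
    induction i with
    | zero => exact fun _ => p.getVert_zero
    | succ i ih =>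
      intro hi
      refine ⟨p.getVert i, ?_, ih (by omega), p.adj_getVert_succ (by omega)⟩
      by_cases h : p.getVert i = v
      · rwa [h]
      · refine hin _ (p.getVert_mem_support i) h fun h' => ?_
        have := hp.getVert_injOn (show i ≤ p.length by omega) (show p.length ≤ p.length from le_rfl)
          (h'.trans p.getVert_length.symm)
        omega
  simpa using hreach p.length le_rfl

/-- Removing vertices without large fans one by one gives an order without large fans. -/
theorem exists_linearOrder_of_no_fan {V : Type*} [Finite V] {G : SimpleGraph V} {r K : ℕ}
    (h : ∀ S : Finset V, S.Nonempty → ∃ v ∈ S, ¬ HasFan G r K (S : Set V) v) :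
    ∃ _ : LinearOrder V, ∀ x, ¬ HasFan G r K (Set.Iic x) x := by
  classical
  have := Fintype.ofFinite V
  have key : ∀ S : Finset V, ∃ f : V → ℕ, Set.InjOn f S ∧
      ∀ x ∈ S, ¬ HasFan G r K {y | y ∈ S ∧ f y ≤ f x} x := by
    intro S
    induction S using Finset.strongInduction with
    | H S ih =>
      rcases S.eq_empty_or_nonempty with rfl | hne
      · exact ⟨fun _ => 0, by simp, by simp⟩
      obtain ⟨v, hv, hfan⟩ := h S hne
      obtain ⟨f, hinj, hf⟩ := ih (S.erase v) (Finset.erase_ssubset hv)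
      have hlt : ∀ x ∈ S, x ≠ v → f x < (S.sup f) + 1 := fun x hx _ =>
        Nat.lt_succ_of_le (Finset.le_sup hx)
      -- The vertex without a large fan into all of `S` becomes the greatest element of `S`.
      refine ⟨Function.update f v (S.sup f + 1), ?_, fun x hx => ?_⟩
      · intro x hx y hy hxy
        by_cases h1 : x = v <;> by_cases h2 : y = v
        · rw [h1, h2]
        · subst h1
          rw [Function.update_self, Function.update_of_ne h2] at hxy
          exact absurd hxy.symm (hlt y hy h2).ne
        · subst h2
          rw [Function.update_self, Function.update_of_ne h1] at hxy
          exact absurd hxy (hlt x hx h1).ne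
        · rw [Function.update_of_ne h1, Function.update_of_ne h2] at hxy
          exact hinj (by simpa [h1] using hx) (by simpa [h2] using hy) hxy
      · by_cases h1 : x = v
        · subst h1
          have : {y | y ∈ S ∧ Function.update f x (S.sup f + 1) y ≤
              Function.update f x (S.sup f + 1) x} = (S : Set V) := by
            ext y
            simp only [Set.mem_ofPred_eq, Function.update_self, Finset.mem_coe, and_iff_left_iff_imp]
            intro hy
            by_cases h2 : y = x
            · subst h2; simp
            · rw [Function.update_of_ne h2]; exact (hlt y hy h2).le
          rwa [this]
        · have : {y | y ∈ S ∧ Function.update f v (S.sup f + 1) y ≤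
              Function.update f v (S.sup f + 1) x} = {y | y ∈ S.erase v ∧ f y ≤ f x} := by
            ext y
            simp only [Set.mem_ofPred_eq, Function.update_of_ne h1, Finset.mem_erase]
            by_cases h2 : y = v
            · subst h2
              simpa using fun _ => (hlt x hx h1)
            · simp [h2]
          rw [this]
          exact hf x (by simpa [h1] using hx)
  obtain ⟨f, hinj, hf⟩ := key Finset.univ
  refine ⟨LinearOrder.lift' f fun x y hxy => hinj (by simp) (by simp) hxy, fun x hx => ?_⟩
  refine hf x (Finset.mem_univ _) ?_
  convert hx using 1
  ext y
  simp only [Finset.mem_univ, true_and, Set.mem_ofPred_eq, Set.mem_Iic]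
  exact Iff.rfl

/-! ### Sparse shallow minors forbid large fans everywhere -/

/-- Contracting the sets `B a` gives a depth-`ρ` minor on `M`. The pairs are ordered and inject into
its darts, whence the factor 2. -/
theorem FiniteGraph.card_pairs_le {G : FiniteGraph.{u}} {ρ c : ℕ}
    (hc : ∀ H : FiniteGraph.{u}, H.IsShallowMinor ρ G →
      H.graph.edgeSet.ncard ≤ c * Nat.card H.V)
    (M : Finset G.V) (P : Finset (G.V × G.V)) (hP : ∀ e ∈ P, e.1 ∈ M ∧ e.2 ∈ M ∧ e.1 ≠ e.2)
    (B : G.V → Set G.V) (hself : ∀ a ∈ M, a ∈ B a)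
    (hdisj : ∀ a ∈ M, ∀ b ∈ M, a ≠ b → Disjoint (B a) (B b))
    (hrad : ∀ a ∈ M, ∀ x ∈ B a, ∃ p : G.graph.Walk a x, p.length ≤ ρ ∧ ∀ w ∈ p.support, w ∈ B a)
    (hadj : ∀ e ∈ P, ∃ x ∈ B e.1, ∃ y ∈ B e.2, G.graph.Adj x y) :
    P.card ≤ 2 * c * M.card := by
  classical
  let H : SimpleGraph M := SimpleGraph.fromRel fun a b => (a.1, b.1) ∈ P
  have hH : (FiniteGraph.mk M inferInstance H).IsShallowMinor ρ G := by
    refine ⟨fun a => B a.1, fun a => a.1, fun a b hab => hdisj _ a.2 _ b.2 fun h =>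
      hab (Subtype.ext h), fun a => hself _ a.2, fun a => hrad _ a.2, ?_⟩
    rintro a b ⟨-, hab | hab⟩
    · exact hadj _ hab
    · obtain ⟨x, hx, y, hy, h⟩ := hadj _ hab
      exact ⟨y, hy, x, hx, h.symm⟩
  have h1 : H.edgeSet.ncard ≤ c * Nat.card M := hc _ hH
  have h2 : P.card ≤ Fintype.card H.Dart := by
    rw [← Fintype.card_coe]
    refine Fintype.card_le_of_injective (fun e => (⟨(⟨e.1.1, (hP _ e.2).1⟩, ⟨e.1.2, (hP _ e.2).2.1⟩),
      ?_⟩ : H.Dart)) ?_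
    · refine ⟨fun h => (hP _ e.2).2.2 (congrArg Subtype.val h), .inl e.2⟩
    · intro e e' h
      have h' := congrArg SimpleGraph.Dart.toProd h
      simp only [Prod.mk.injEq, Subtype.mk.injEq] at h'
      exact Subtype.ext (Prod.ext h'.1 h'.2)
  rw [H.dart_card_eq_twice_card_edges, ← SimpleGraph.coe_edgeFinset, Set.ncard_coe_finset] at *
  simp only [Nat.card_eq_fintype_card, Fintype.card_coe] at h1
  calc P.card ≤ 2 * H.edgeFinset.card := h2
    _ ≤ 2 * (c * M.card) := Nat.mul_le_mul_left _ h1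
    _ = 2 * c * M.card := by ring

/-- A sparse set of pairs has a large independent set. -/
theorem exists_independent {V : Type*} [DecidableEq V] (S : Finset V) (E : Finset (V × V)) (m : ℕ)
    (hE : ∀ e ∈ E, e.1 ∈ S ∧ e.2 ∈ S ∧ e.1 ≠ e.2) (hm : E.card ≤ m * S.card) :
    ∃ R ⊆ S, (∀ a ∈ R, ∀ b ∈ R, (a, b) ∉ E) ∧ S.card ≤ 2 * (4 * m + 1) * R.card := by
  let inc : V → Finset (V × V) := fun v => E.filter fun e => e.1 = v ∨ e.2 = v
  have hsum : ∑ v ∈ S, (inc v).card ≤ 2 * E.card := by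
    have h1 : ∀ e ∈ E, (S.filter fun v => e.1 = v ∨ e.2 = v).card ≤ 2 := fun e _ => by
      refine (Finset.card_le_card (t := {e.1, e.2}) fun v hv => ?_).trans Finset.card_le_two
      simp only [Finset.mem_filter] at hv
      simp only [Finset.mem_insert, Finset.mem_singleton]
      exact hv.2.imp Eq.symm Eq.symm
    calc ∑ v ∈ S, (inc v).card = ∑ e ∈ E, (S.filter fun v => e.1 = v ∨ e.2 = v).card :=
          Finset.sum_card_bipartiteAbove_eq_sum_card_bipartiteBelow
            (fun v (e : V × V) => e.1 = v ∨ e.2 = v)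
      _ ≤ ∑ e ∈ E, 2 := Finset.sum_le_sum h1
      _ = 2 * E.card := by rw [Finset.sum_const, smul_eq_mul, mul_comm]
  -- The average degree is at most `2 * m`, so at least half of `S` has degree at most `4 * m`. The
  -- closed neighbourhoods of a maximum independent subset `R` of `L` cover `L`.
  let L := S.filter fun v => (inc v).card ≤ 4 * m
  have hL : S.card ≤ 2 * L.card := by
    have h1 : (S.filter fun v => ¬ (inc v).card ≤ 4 * m).card * (4 * m + 1) ≤ 2 * E.card :=
      calc _ = ∑ v ∈ S.filter fun v => ¬ (inc v).card ≤ 4 * m, (4 * m + 1) := by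
            rw [Finset.sum_const, smul_eq_mul]
        _ ≤ ∑ v ∈ S.filter fun v => ¬ (inc v).card ≤ 4 * m, (inc v).card :=
            Finset.sum_le_sum fun v hv => by
              have := (Finset.mem_filter.1 hv).2
              omega
        _ ≤ ∑ v ∈ S, (inc v).card :=
            Finset.sum_le_sum_of_subset (Finset.filter_subset _ _)
        _ ≤ _ := hsum
    have h2 : L.card + (S.filter fun v => ¬ (inc v).card ≤ 4 * m).card = S.card :=
      Finset.card_filter_add_card_filter_not _
    nlinarith
  obtain ⟨R, hR, hmax⟩ := Finset.exists_max_image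
    (L.powerset.filter fun R => ∀ a ∈ R, ∀ b ∈ R, (a, b) ∉ E) Finset.card ⟨∅, by simp⟩
  simp only [Finset.mem_filter, Finset.mem_powerset] at hR hmax
  refine ⟨R, hR.1.trans (Finset.filter_subset _ _), hR.2, ?_⟩
  have hcov : L ⊆ R.biUnion fun u => insert u ((inc u).image fun e => if e.1 = u then e.2 else e.1) := by
    intro v hv
    simp only [Finset.mem_biUnion, Finset.mem_insert]
    by_cases hvR : v ∈ R
    · exact ⟨v, hvR, .inl rfl⟩
    by_contra hno
    push Not at hno
    have hno' : ∀ u ∈ R, (u, v) ∉ E ∧ (v, u) ∉ E := fun u hu => by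
      have h := (hno u hu).2
      simp only [Finset.mem_image, not_exists, not_and, inc, Finset.mem_filter] at h
      refine ⟨fun h' => h (u, v) ⟨h', .inl rfl⟩ (by simp), fun h' => h (v, u) ⟨h', .inr rfl⟩ ?_⟩
      have hne : v ≠ u := fun hvu => hvR (hvu ▸ hu)
      simp [hne]
    have := hmax (insert v R) ⟨Finset.insert_subset hv hR.1, fun a ha b hb => by
      rw [Finset.mem_insert] at ha hb
      rcases ha with rfl | ha <;> rcases hb with rfl | hb
      · exact fun h => (hE _ h).2.2 rfl
      · exact (hno' b hb).2
      · exact (hno' a ha).1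
      · exact hR.2 a ha b hb⟩
    rw [Finset.card_insert_of_notMem hvR] at this
    omega
  have hLR : L.card ≤ R.card * (4 * m + 1) :=
    (Finset.card_le_card hcov).trans <| Finset.card_biUnion_le_card_mul _ _ _ fun u hu => by
      refine (Finset.card_insert_le _ _).trans (Nat.succ_le_succ (Finset.card_image_le.trans ?_))
      exact (Finset.mem_filter.1 (hR.1 hu)).2
  nlinarith

/-- `J` is the set of inner vertices of a short connection outside `S` between `a` and `b`. -/
structure IsConnector {V : Type*} (G : SimpleGraph V) (r : ℕ) (S : Set V) (a b : V)
    (J : Finset V) : Prop where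
  avoid : ∀ x ∈ J, x ∉ S
  card_le : J.card ≤ 2 * r
  -- Asymmetric in `a` and `b`: the connector will be contracted into its first endpoint `a`.
  reach : ∀ x ∈ J, ∃ q : G.Walk a x, q.length ≤ 2 * r ∧ ∀ w ∈ q.support, w = a ∨ w ∈ J
  link : ∃ x, (x = a ∨ x ∈ J) ∧ G.Adj x b

theorem IsConnector.of_seq {V : Type*} [DecidableEq V] {G : SimpleGraph V} {r : ℕ} {S : Set V}
    {n : ℕ} (s : ℕ → V) (h0 : 0 < n) (hn : n ≤ 2 * r + 1)
    (hadj : ∀ j < n, G.Adj (s j) (s (j + 1))) (hS : ∀ j, 0 < j → j < n → s j ∉ S) :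
    IsConnector G r S (s 0) (s n) ((Finset.Ioo 0 n).image s) := by
  refine ⟨fun x hx => ?_, Finset.card_image_le.trans (by rw [Nat.card_Ioo]; omega), fun x hx => ?_,
    s (n - 1), ?_, ?_⟩
  · obtain ⟨j, hj, rfl⟩ := Finset.mem_image.1 hx
    rw [Finset.mem_Ioo] at hj
    exact hS j hj.1 hj.2
  · obtain ⟨j, hj, rfl⟩ := Finset.mem_image.1 hx
    rw [Finset.mem_Ioo] at hj
    obtain ⟨q, hq, hs⟩ := exists_walk_of_seq s j fun i hi => hadj i (hi.trans hj.2)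
    refine ⟨q, by omega, fun w hw => ?_⟩
    obtain ⟨i, hi, rfl⟩ := hs w hw
    rcases Nat.eq_zero_or_pos i with rfl | hpos
    · exact .inl rfl
    · exact .inr (Finset.mem_image_of_mem s (Finset.mem_Ioo.2 ⟨hpos, by omega⟩))
  · rcases Nat.eq_zero_or_pos (n - 1) with h | h
    · exact .inl (by rw [h])
    · exact .inr (Finset.mem_image_of_mem s (Finset.mem_Ioo.2 ⟨h, by omega⟩))
  · have := hadj (n - 1) (by omega)
    rwa [Nat.sub_add_cancel h0] at this

/-- Two walks with the same end give a connector between their starting points. -/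
theorem IsConnector.of_seqs {V : Type*} {G : SimpleGraph V} {r : ℕ} {S : Set V}
    {p q : ℕ → V} {m n : ℕ} (hm : 0 < m) (hn : 0 < n) (hmr : m ≤ r) (hnr : n ≤ r)
    (hp : ∀ j < m, G.Adj (p j) (p (j + 1))) (hq : ∀ j < n, G.Adj (q j) (q (j + 1)))
    (hpq : p m = q n) (hpS : ∀ j, 0 < j → j ≤ m → p j ∉ S) (hqS : ∀ j, 0 < j → j ≤ n → q j ∉ S) :
    ∃ J, IsConnector G r S (p 0) (q 0) J := by
  classical
  -- Follow `p` up to the common vertex, then `q` backwards.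
  let s : ℕ → V := fun k => if k ≤ m then p k else q (m + n - k)
  have hs : ∀ k, m ≤ k → s k = q (m + n - k) := by
    intro k hk
    rcases hk.lt_or_eq with h | rfl
    · exact if_neg (by omega)
    · simp only [s, le_refl, if_true, hpq]
      congr 1
      omega
  have hs' : ∀ k, k ≤ m → s k = p k := fun k hk => if_pos hk
  have h := IsConnector.of_seq (G := G) (r := r) (S := S) (n := m + n) s (by omega) (by omega)
    (fun k hk => ?_) fun k hk hk' => ?_
  · rw [hs' 0 (by omega), hs (m + n) (by omega), Nat.sub_self] at h
    exact ⟨_, h⟩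
  · by_cases hkm : k < m
    · rw [hs' k hkm.le, hs' (k + 1) hkm]
      exact hp k hkm
    · rw [hs k (by omega), hs (k + 1) (by omega)]
      have := hq (m + n - (k + 1)) (by omega)
      rw [show m + n - (k + 1) + 1 = m + n - k by omega] at this
      exact this.symm
  · by_cases hkm : k ≤ m
    · rw [hs' k hkm]
      exact hpS k hk hkm
    · rw [hs k (by omega)]
      exact hqS _ (by omega) (by omega)

/-- A family of disjoint connectors between the pairs in `E` of elements of `S`. -/
structure IsLinkage {V : Type*} (G : SimpleGraph V) (r : ℕ) (S : Finset V) (E : Finset (V × V))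
    (I : V × V → Finset V) : Prop where
  mem : ∀ e ∈ E, e.1 ∈ S ∧ e.2 ∈ S ∧ e.1 ≠ e.2
  connector : ∀ e ∈ E, IsConnector G r S e.1 e.2 (I e)
  disj : ∀ e ∈ E, ∀ e' ∈ E, e ≠ e' → Disjoint (I e) (I e')

theorem IsLinkage.insert {V : Type*} [DecidableEq V] {G : SimpleGraph V} {r : ℕ} {S : Finset V}
    {E : Finset (V × V)} {I : V × V → Finset V} (h : IsLinkage G r S E I) {a b : V} (ha : a ∈ S)
    (hb : b ∈ S) (hab : a ≠ b) (he : (a, b) ∉ E) {J : Finset V} (hJ : IsConnector G r S a b J)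
    (hJI : ∀ e ∈ E, Disjoint J (I e)) :
    IsLinkage G r S (insert (a, b) E) (Function.update I (a, b) J) := by
  have hne : ∀ e ∈ E, e ≠ (a, b) := fun e h h' => he (h' ▸ h)
  refine ⟨fun e h' => ?_, fun e h' => ?_, fun e h1 e' h2 h3 => ?_⟩
  · rcases Finset.mem_insert.1 h' with rfl | h'
    exacts [⟨ha, hb, hab⟩, h.mem e h']
  · rcases Finset.mem_insert.1 h' with rfl | h'
    · rwa [Function.update_self]
    · rw [Function.update_of_ne (hne e h')]
      exact h.connector e h'
  · rcases Finset.mem_insert.1 h1 with rfl | h1 <;> rcases Finset.mem_insert.1 h2 with rfl | h2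
    · exact absurd rfl h3
    · rw [Function.update_self, Function.update_of_ne (hne e' h2)]
      exact hJI e' h2
    · rw [Function.update_self, Function.update_of_ne (hne e h1)]
      exact (hJI e h1).symm
    · rw [Function.update_of_ne (hne e h1), Function.update_of_ne (hne e' h2)]
      exact h.disj e h1 e' h2 h3

theorem exists_max_linkage {V : Type*} [Finite V] (G : SimpleGraph V) (r : ℕ) (S : Finset V) :
    ∃ E I, IsLinkage G r S E I ∧ ∀ E' I', IsLinkage G r S E' I' → E'.card ≤ E.card := by
  obtain ⟨E, ⟨I, hI⟩, hmax⟩ := Set.exists_max_image {E | ∃ I, IsLinkage G r S E I} Finset.card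
    (Set.toFinite _) ⟨∅, fun _ => ∅, by constructor <;> simp⟩
  exact ⟨E, I, hI, fun E' I' h => hmax E' ⟨I', h⟩⟩

theorem FiniteGraph.exists_no_fan {G : FiniteGraph.{u}} {r c : ℕ}
    (hc : ∀ H : FiniteGraph.{u}, H.IsShallowMinor (2 * r) G →
      H.graph.edgeSet.ncard ≤ c * Nat.card H.V) (S : Finset G.V) (hS : S.Nonempty) :
    ∃ v ∈ S, ¬ HasFan G.graph r
      (2 * c * (1 + 2 * r * (2 * c)) * (2 * (4 * (2 * c) + 1)) + 1) (S : Set G.V) v := by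
  classical
  have := G.finite
  by_contra hcon
  push Not at hcon
  generalize hKdef : 2 * c * (1 + 2 * r * (2 * c)) * (2 * (4 * (2 * c) + 1)) + 1 = K at hcon
  obtain ⟨E, I, hlink, hmax⟩ := exists_max_linkage G.graph r S
  have hEcard : E.card ≤ 2 * c * S.card := by
    -- Each `a` absorbs the connectors that start at it.
    refine card_pairs_le hc S E hlink.mem (fun a => {x | x = a ∨ ∃ e ∈ E, e.1 = a ∧ x ∈ I e})
      (fun a _ => .inl rfl) ?_ ?_ ?_
    · intro a ha b hb hab
      rw [Set.disjoint_left]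
      rintro x (rfl | ⟨e, he, rfl, hx⟩) (rfl | ⟨e', he', rfl, hx'⟩)
      · exact hab rfl
      · exact (hlink.connector e' he').avoid x hx' ha
      · exact (hlink.connector e he).avoid x hx hb
      · exact Finset.disjoint_left.1
          (hlink.disj e he e' he' fun h => hab (congrArg Prod.fst h)) hx hx'
    · rintro a ha x (rfl | ⟨e, he, rfl, hx⟩)
      · exact ⟨.nil, by simp, fun w hw => .inl (by simpa using hw)⟩
      · obtain ⟨q, hq, hs⟩ := (hlink.connector e he).reach x hx
        exact ⟨q, hq, fun w hw => (hs w hw).imp_right fun h => ⟨e, he, rfl, h⟩⟩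
    · intro e he
      obtain ⟨x, hx, hadj⟩ := (hlink.connector e he).link
      exact ⟨x, hx.imp_right fun h => ⟨e, he, rfl, h⟩, e.2, .inl rfl, hadj⟩
  obtain ⟨R, hRS, hRE, hRcard⟩ := exists_independent S E (2 * c) hlink.mem hEcard
  let M : Finset G.V := S ∪ E.biUnion I
  have hSM : S ⊆ M := Finset.subset_union_left
  have hMcard : M.card ≤ S.card * (1 + 2 * r * (2 * c)) := by
    have h1 : (E.biUnion I).card ≤ E.card * (2 * r) :=
      Finset.card_biUnion_le_card_mul _ _ _ fun e he => (hlink.connector e he).card_le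
    calc M.card ≤ S.card + (E.biUnion I).card := Finset.card_union_le _ _
      _ ≤ S.card + 2 * c * S.card * (2 * r) :=
          Nat.add_le_add_left (h1.trans (Nat.mul_le_mul_right _ hEcard)) _
      _ = _ := by ring
  -- The fans are cut where they enter `M`, so their inner vertices avoid all connectors.
  have hfans : ∀ v, ∃ (p : Fin K → ℕ → G.V) (l : Fin K → ℕ), v ∈ S →
      IsFan G.graph r (M : Set G.V) v p l := by
    intro v
    by_cases hv : v ∈ S
    · obtain ⟨p, l, h⟩ := hcon v hv
      obtain ⟨l', -, h'⟩ := h.truncate (M := (M : Set G.V)) hv (by exact_mod_cast hSM)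
      exact ⟨p, l', fun _ => h'⟩
    · exact ⟨fun _ _ => v, fun _ => 0, fun h => absurd h hv⟩
  choose p l hfan using hfans
  -- If fans of distinct `a`, `b` met in inner vertices, they would contain a new connector outside
  -- `M`. As `(a, b) ∉ E`, this would enlarge the maximal linkage.
  have hcross : ∀ a ∈ R, ∀ b ∈ R, ∀ i j i' j', 0 < j → j < l a i → 0 < j' → j' < l b i' →
      p a i j = p b i' j' → a = b := by
    intro a ha b hb i j i' j' hj hjl hj' hjl' heq
    by_contra hab
    have hfa := hfan a (hRS ha)
    have hfb := hfan b (hRS hb)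
    obtain ⟨J, hJ⟩ := IsConnector.of_seqs (G := G.graph) (r := r) (S := (M : Set G.V)) hj hj'
      (hjl.le.trans (hfa.length_le i)) (hjl'.le.trans (hfb.length_le i'))
      (fun k hk => hfa.adj i k (hk.trans hjl)) (fun k hk => hfb.adj i' k (hk.trans hjl')) heq
      (fun k hk hk' => hfa.inner i k hk (hk'.trans_lt hjl))
      (fun k hk hk' => hfb.inner i' k hk (hk'.trans_lt hjl'))
    rw [hfa.start, hfb.start] at hJ
    have hJ' : IsConnector G.graph r (S : Set G.V) a b J :=
      ⟨fun x hx h => hJ.avoid x hx (hSM h), hJ.card_le, hJ.reach, hJ.link⟩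
    have hnew := hlink.insert (hRS ha) (hRS hb) hab (hRE a ha b hb) hJ' fun e he =>
      Finset.disjoint_left.2 fun x hx hxI => hJ.avoid x hx
        (Finset.mem_union_right _ (Finset.mem_biUnion.2 ⟨e, he, hxI⟩))
    have := hmax _ _ hnew
    rw [Finset.card_insert_of_notMem (hRE a ha b hb)] at this
    omega
  let P : Finset (G.V × G.V) := (R ×ˢ (Finset.univ : Finset (Fin K))).image fun x =>
    (x.1, p x.1 x.2 (l x.1 x.2))
  have hPcard : P.card = R.card * K := by
    rw [Finset.card_image_of_injOn, Finset.card_product, Finset.card_univ, Fintype.card_fin]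
    rintro ⟨a, i⟩ hx ⟨b, i'⟩ - h
    simp only [Prod.mk.injEq] at h
    obtain ⟨rfl, h⟩ := h
    have ha : a ∈ R := (Finset.mem_product.1 (Finset.mem_coe.1 hx)).1
    rw [(hfan a (hRS ha)).last_injective h]
  -- Second contraction, now on `M`: each `a ∈ R` absorbs the inner vertices of its fan and is then
  -- adjacent to its `K` distinct endpoints.
  have hPM : P.card ≤ 2 * c * M.card := by
    refine card_pairs_le hc M P ?_
      (fun a => {x | x = a ∨ a ∈ R ∧ ∃ i j, 0 < j ∧ j < l a i ∧ x = p a i j})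
      (fun a _ => .inl rfl) ?_ ?_ ?_
    · intro e he
      obtain ⟨⟨a, i⟩, hx, rfl⟩ := Finset.mem_image.1 he
      have ha := hRS (Finset.mem_product.1 hx).1
      exact ⟨hSM ha, (hfan a ha).last_mem i, ((hfan a ha).last_ne i).symm⟩
    · intro a ha b hb hab
      rw [Set.disjoint_left]
      rintro x (rfl | ⟨haR, i, j, hj, hjl, rfl⟩) (rfl | ⟨hbR, i', j', hj', hjl', hx⟩)
      · exact hab rfl
      · exact (hfan b (hRS hbR)).inner i' j' hj' hjl' (hx ▸ ha)
      · exact (hfan a (hRS haR)).inner i j hj hjl hb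
      · exact hab (hcross a haR b hbR i j i' j' hj hjl hj' hjl' hx)
    · rintro a ha x (rfl | ⟨haR, i, j, hj, hjl, rfl⟩)
      · exact ⟨.nil, by simp, fun w hw => .inl (by simpa using hw)⟩
      · have hfa := hfan a (hRS haR)
        obtain ⟨q, hq, hs⟩ := exists_walk_of_seq (p a i) j fun k hk => hfa.adj i k (hk.trans hjl)
        have := hfa.length_le i
        refine ⟨q.copy (hfa.start i) rfl, by rw [SimpleGraph.Walk.length_copy]; omega,
          fun w hw => ?_⟩
        rw [SimpleGraph.Walk.support_copy] at hw
        obtain ⟨k, hk, rfl⟩ := hs w hw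
        rcases Nat.eq_zero_or_pos k with rfl | hpos
        · exact .inl (hfa.start i)
        · exact .inr ⟨haR, i, k, hpos, by omega, rfl⟩
    · intro e he
      obtain ⟨⟨a, i⟩, hx, rfl⟩ := Finset.mem_image.1 he
      have haR := (Finset.mem_product.1 hx).1
      have hfa := hfan a (hRS haR)
      have hpos := hfa.length_pos i
      refine ⟨p a i (l a i - 1), ?_, p a i (l a i), .inl rfl, ?_⟩
      · rcases Nat.eq_zero_or_pos (l a i - 1) with h | h
        · exact .inl (by rw [h]; exact hfa.start i)
        · exact .inr ⟨haR, i, _, h, Nat.sub_lt hpos Nat.one_pos, rfl⟩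
      · have := hfa.adj i (l a i - 1) (by omega)
        rwa [Nat.sub_add_cancel hpos] at this
  have hRpos : 0 < R.card := by
    by_contra h
    have := hS.card_pos
    rw [Nat.eq_zero_of_not_pos h] at hRcard
    omega
  -- `K - 1` is the product of the losses: density on `M`, passage from `S` to `M`, passage from `R`
  -- to `S`.
  have hle : R.card * K ≤ R.card * (K - 1) := by
    calc R.card * K = P.card := hPcard.symm
      _ ≤ 2 * c * (S.card * (1 + 2 * r * (2 * c))) := hPM.trans (Nat.mul_le_mul_left _ hMcard)
      _ ≤ 2 * c * (2 * (4 * (2 * c) + 1) * R.card * (1 + 2 * r * (2 * c))) :=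
          Nat.mul_le_mul_left _ (Nat.mul_le_mul_right _ hRcard)
      _ = R.card * (K - 1) := by rw [← hKdef, Nat.add_sub_cancel]; ring
  have := Nat.le_of_mul_le_mul_left hle hRpos
  omega

/-! ### The equivalence -/

theorem corollary1p8 (C : GraphClass.{u}) :
    GraphClass.BoundedExpansion C ↔ ∀ r : ℕ, GraphClass.sepWidth C (r : ℕ∞) < ⊤ := by
  constructor
  · intro h r
    obtain ⟨c, hc⟩ := h (2 * r)
    refine lt_of_le_of_lt (b := (((2 * c * (1 + 2 * r * (2 * c)) * (2 * (4 * (2 * c) + 1)) + 1) ^ r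
      : ℕ) : ℕ∞)) (iSup₂_le fun G hG => Nat.cast_le.2 (Nat.sInf_le ?_)) (ENat.natCast_lt_top _)
    have := G.finite
    obtain ⟨o, ho⟩ := exists_linearOrder_of_no_fan (FiniteGraph.exists_no_fan (hc G hG))
    exact ⟨o, fun S hS v hv => FiniteGraph.encard_sep_le_of_no_fan ho hS hv⟩
  · intro h r
    obtain ⟨k, hk⟩ := ENat.ne_top_iff_exists.1 (h (4 * r + 1)).ne
    refine ⟨k, fun G hG H hHG => ?_⟩
    have hle : G.sepWidth ((4 * r + 1 : ℕ) : ℕ∞) ≤ k := by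
      rw [← Nat.cast_le (α := ℕ∞), hk]
      exact le_iSup₂_of_le G hG le_rfl
    obtain ⟨o, ho⟩ := Nat.sInf_mem (G.sepWidth_set_nonempty ((4 * r + 1 : ℕ) : ℕ∞))
    exact hHG.ncard_edgeSet_le fun S hS v hv => (ho S hS v hv).trans (by exact_mod_cast hle)
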